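/- **Setting.** Let $L_2(\mathbb C)$ be the Hilbert space of square-integrable signals $u:\mathbb R\to\mathbb C$. For an operator $R:L_2(\mathbb C)\to L_2(\mathbb C)$ and $u_1\ne u_2$ put $$z_R(u_1,u_2)=\frac{\|Ru_1-Ru_2\|}{\|u_1-u_2\|}\,e^{i\angle(u_1-u_2,\,Ru_1-Ru_2)},\qquad \angle(x,y)=\arccos\frac{\operatorname{Re}\langle x,y\rangle}{\|x\|\,\|y\|}$$ (with value $0$ if $Ru_1=Ru_2$), and $\mathrm{SRG}(R)=\{z_R(u_1,u_2): u_1\neq u_2 \text{ in } L_2(\mathbb C)\}$. Let $\mathrm{SRG}^{\sim}(R)$ be the scaled relative graph in which finite sums of complex sinusoids are admitted as inputs too, treated as limits of their truncations: it is the set of all limits $\lim_{T\to\infty} z_R(p_1\mathbf 1_{[-T,T]}+v_1,\;p_2\mathbf 1_{[-T,T]}+v_2)$ that exist, where $p_k(t)=\sum_\omega a_{k,\omega}e^{j\omega t}$ are finite sums, $v_k\in L_2(\mathbb C)$, and $(p_1,v_1)\ne(p_2,v_2)$. Taking $p_1=p_2=0$ shows $\mathrm{SRG}(R)\subseteq \mathrm{SRG}^{\sim}(R)$.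 Let $\mathbb C_{\mathrm{Im}\ge0}$ be the closed upper half plane. For $z_1,z_2\in\mathbb C_{\mathrm{Im}\ge 0}$ let $\mathrm{Arc}_{\min}(z_1,z_2)$ be the segment $[z_1,z_2]$ if $\operatorname{Re}z_1=\operatorname{Re}z_2$, and otherwise the arc between $z_1$ and $z_2$, in $\mathbb C_{\mathrm{Im}\ge0}$, of the circle through $z_1,z_2$ with centre on the real axis (the geodesic of the Poincaré half plane, which is a straight segment in the Beltrami–Klein model). A set $S\subseteq\mathbb C_{\mathrm{Im}\ge0}$ is h-convex if $\mathrm{Arc}_{\min}(z_1,z_2)\subseteq S$ for all $z_1,z_2\in S$; the h-convex hull of $P\subseteq\mathbb C_{\mathrm{Im}\ge0}$ is the smallest h-convex set containing $P$. **Theorem.** Let $g:L_2(\mathbb C)\to L_2(\mathbb C)$ be linear and time invariant with transfer function $G$, i.e. $\widehat{gu}(\omega)=G(j\omega)\,\hat u(\omega)$ for every $u\in L_2(\mathbb C)$ and almost every $\omega$, where $\omega\mapsto G(j\omega)$ is continuous on $\mathbb R$. Let $N=\{G(j\omega):\omega\in\mathbb R\}$ be its Nyquist diagram. 1. If $N$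 is symmetric about the real axis (for instance if $g$ maps real signals to real signals), then $\mathrm{SRG}^{\sim}(g)\cap\mathbb C_{\mathrm{Im}\ge0}$ is equal to the h-convex hull of $N\cap\mathbb C_{\mathrm{Im}\ge0}$. Moreover $\mathrm{SRG}(g)\cap\mathbb C_{\mathrm{Im}\ge0}$ is contained in this hull, and the hull is contained in the closure of $\mathrm{SRG}(g)\cap\mathbb C_{\mathrm{Im}\ge0}$. 2. Without the symmetry assumption, the same three assertions hold with $(N\cup\overline N)\cap\mathbb C_{\mathrm{Im}\ge0}$ in place of $N\cap\mathbb C_{\mathrm{Im}\ge0}$, where $\overline N=\{\bar z: z\in N\}$. -/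

import Mathlib

open Set Filter Topology MeasureTheory
open scoped FourierTransform ComplexConjugate

noncomputable section

/-! ### Scaled relative graphs over a complex Hilbert space -/

section SRG

variable {H : Type*} [NormedAddCommGroup H] [InnerProductSpace ℂ H]

/-- The angle `arccos (Re ⟨x, y⟩ / (‖x‖ ‖y‖))` between two vectors; it lies in `[0, π]`. -/
def hilbertAngle (x y : H) : ℝ :=
  Real.arccos ((inner ℂ x y).re / (‖x‖ * ‖y‖))

/-- The complex number `z_R(u₁, u₂)`: its modulus is the gain and its argument the phase shift
of the operator `R` on the pair of inputs `u₁, u₂`. It equals `0` if `R u₁ = R u₂`. -/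
def srgPoint (R : H → H) (u₁ u₂ : H) : ℂ :=
  ((‖R u₁ - R u₂‖ / ‖u₁ - u₂‖ : ℝ) : ℂ) *
    Complex.exp (Complex.I * (hilbertAngle (u₁ - u₂) (R u₁ - R u₂) : ℝ))

/-- The scaled relative graph of an everywhere defined operator `R : H → H`. -/
def srg (R : H → H) : Set ℂ :=
  {z | ∃ u₁ u₂ : H, u₁ ≠ u₂ ∧ z = srgPoint R u₁ u₂}

end SRG

/-! ### Hyperbolic convexity in the closed upper half plane -/

/-- The closed upper half plane. -/
def closedUpperHalfPlane : Set ℂ := {z | 0 ≤ z.im}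

/-- The minimal arc between `z₁` and `z₂`: the segment `[z₁, z₂]` if they have the same real
part, and otherwise the part between `z₁` and `z₂`, in the closed upper half plane, of the circle
through `z₁` and `z₂` whose centre `c` is real. -/
def arcMin (z₁ z₂ : ℂ) : Set ℂ :=
  {z | (z₁.re = z₂.re ∧ z ∈ segment ℝ z₁ z₂) ∨
    (z₁.re ≠ z₂.re ∧ z ∈ closedUpperHalfPlane ∧ z.re ∈ uIcc z₁.re z₂.re ∧
      ∃ c r : ℝ, ‖z₁ - c‖ = r ∧ ‖z₂ - c‖ = r ∧ ‖z - c‖ = r)}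

/-- Hyperbolic convexity of a subset of the closed upper half plane. -/
def IsHConvex (S : Set ℂ) : Prop :=
  S ⊆ closedUpperHalfPlane ∧ ∀ z₁ ∈ S, ∀ z₂ ∈ S, arcMin z₁ z₂ ⊆ S

/-- The h-convex hull: the smallest h-convex set that contains `P`. -/
def hConvexHull (P : Set ℂ) : Set ℂ := ⋂₀ {S | IsHConvex S ∧ P ⊆ S}

/-- The closed upper half plane is h-convex, so that the hull of each of its subsets is the
intersection of a nonempty family. -/
theorem isHConvex_closedUpperHalfPlane : IsHConvex closedUpperHalfPlane := by
  refine ⟨subset_rfl, fun z₁ h₁ z₂ h₂ z hz => ?_⟩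
  rcases hz with ⟨_, a, b, ha, hb, _, rfl⟩ | ⟨_, hz, _⟩
  · simp only [closedUpperHalfPlane, mem_ofPred_eq] at h₁ h₂ ⊢
    simp only [Complex.add_im, Complex.real_smul, Complex.im_ofReal_mul]
    positivity
  · exact hz

theorem hConvexHull_isHConvex {P : Set ℂ} (hP : P ⊆ closedUpperHalfPlane) :
    IsHConvex (hConvexHull P) :=
  ⟨fun _ hz => hz _ ⟨isHConvex_closedUpperHalfPlane, hP⟩,
    fun z₁ h₁ z₂ h₂ _ hz S hS => hS.1.2 z₁ (h₁ S hS) z₂ (h₂ S hS) hz⟩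

/-! ### Linear time-invariant operators on the space of square-integrable signals -/

/-- The space of square-integrable complex-valued signals on the real time axis. -/
abbrev SignalL2 : Type := Lp ℂ 2 (volume : Measure ℝ)

/-- The signal `u` delayed by `τ`, that is `t ↦ u (t - τ)`. -/
def delay (τ : ℝ) (u : SignalL2) : SignalL2 :=
  Lp.compMeasurePreserving (fun t : ℝ => t - τ) (measurePreserving_sub_right volume τ) u

/-- Time invariance: the operator commutes with all time shifts. -/
def IsTimeInvariant (g : SignalL2 → SignalL2) : Prop :=
  ∀ (τ : ℝ) (u : SignalL2), g (delay τ u) = delay τ (g u)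

/-- `G` is a transfer function of `g` (on the imaginary axis): the operator acts on Fourier
transforms as multiplication by `G (jω)`. Mathlib's Fourier transform is in terms of the ordinary
frequency `ξ`, the angular frequency being `ω = 2πξ`. -/
def IsTransferFunction (g : SignalL2 → SignalL2) (G : ℂ → ℂ) : Prop :=
  ∀ u : SignalL2, ((𝓕 (g u) : SignalL2) : ℝ → ℂ) =ᵐ[volume]
    fun ξ : ℝ => G (Complex.I * ((2 * Real.pi * ξ : ℝ) : ℂ)) * ((𝓕 u : SignalL2) : ℝ → ℂ) ξ

/-- The Nyquist diagram `{G (jω) | ω ∈ ℝ}`. -/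
def nyquist (G : ℂ → ℂ) : Set ℂ := range fun ω : ℝ => G (Complex.I * (ω : ℂ))

/-! ### Sinusoidal inputs as limits of square-integrable signals -/

/-- The finite sum of complex sinusoids `t ↦ ∑ a_ω e^{jωt}`. -/
def sinusoids (a : ℝ →₀ ℂ) (t : ℝ) : ℂ :=
  ∑ ω ∈ a.support, a ω * Complex.exp (Complex.I * (ω : ℂ) * (t : ℂ))

theorem continuous_sinusoids (a : ℝ →₀ ℂ) : Continuous (sinusoids a) := by
  unfold sinusoids
  fun_prop

theorem memLp_truncated_sinusoids (a : ℝ →₀ ℂ) (T : ℝ) :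
    MemLp ((Icc (-T) T).indicator (sinusoids a)) 2 (volume : Measure ℝ) := by
  rw [memLp_indicator_iff_restrict measurableSet_Icc]
  obtain ⟨C, hC⟩ := (isCompact_Icc (a := -T) (b := T)).exists_bound_of_continuousOn
    (continuous_sinusoids a).continuousOn
  refine MemLp.of_bound (continuous_sinusoids a).aestronglyMeasurable C ?_
  exact (ae_restrict_iff' measurableSet_Icc).2 (Eventually.of_forall hC)

/-- An input signal `(a, v)` stands for the sum of the sinusoids `∑ a_ω e^{jωt}` and of the
square-integrable signal `v`; here its sinusoids are truncated to the window `[-T, T]`. -/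
def truncatedInput (s : (ℝ →₀ ℂ) × SignalL2) (T : ℝ) : SignalL2 :=
  (memLp_truncated_sinusoids s.1 T).toLp _ + s.2

/-- The scaled relative graph of `R` where, besides square-integrable signals, finite sums of
complex sinusoids are admitted as inputs. The latter are treated as limits of their truncations,
so that the point belonging to two different inputs is the limit, as the window grows, of the
points belonging to the truncated inputs. For two square-integrable inputs the point is the usual
one. -/
def srgWithSinusoids (R : SignalL2 → SignalL2) : Set ℂ :=
  {z | ∃ s₁ s₂ : (ℝ →₀ ℂ) × SignalL2, s₁ ≠ s₂ ∧
    Tendsto (fun T : ℝ => srgPoint R (truncatedInput s₁ T) (truncatedInput s₂ T)) atTop (𝓝 z)}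

end

/-!
In the coordinates `(Re z, |z|²)` on the closed upper half plane (`kleinMap`), circles centred on
the real axis and vertical lines become straight lines, so that the h-convex hull of `P` is the
preimage of the ordinary convex hull of the image of `P` (`hConvexHull_eq`).

In the same coordinates, the point of the scaled relative graph that belongs to an input increment
`x` is `(Re ⟨x, g x⟩ / ‖x‖², ‖g x‖² / ‖x‖²)`. By Plancherel this is the mean of the curve
`ω ↦ (Re G(jω), |G(jω)|²)` with respect to the normalized energy density of `x`. A mean of a
function with values in a convex subset of a finite-dimensional space lies in that set, even if the
set is not closed (`Convex.integral_mem_of_finiteDimensional`), so the point lies in the convex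
hull of the curve (`srgCoord_mem_convexHull`).

Conversely, a sinusoid truncated to `[-T, T]` and normalized is, as `T → ∞`, an approximate
eigenvector of `g` with eigenvalue `G(jω)` (`tendsto_multiplier_unitSinusoid`), and sinusoids of
different frequencies become orthogonal. Hence the point of an input whose sinusoidal part is
`∑ a_ω e^{jωt} ≠ 0` converges to the convex combination of points of the curve with weights
proportional to `|a_ω|²` (`tendsto_truncatedInput`). These limits are exactly the elements of the
convex hull, and the truncated inputs are square integrable, so the limits are also in the closure
of the scaled relative graph (`srgWithSinusoids_eq`).

The operator `g` is not assumed to be bounded; this follows from the closed graph theorem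
(`continuous_of_multiplier`).
-/

/-! ### Means of convex-set-valued functions -/

/-- In finite dimension a point outside a convex set can be weakly separated from it by a nonzero
functional, whether or not the set is closed or open. -/
theorem Convex.exists_dual_le_of_notMem {E : Type*} [NormedAddCommGroup E] [NormedSpace ℝ E]
    [FiniteDimensional ℝ E] {s : Set E} (hs : Convex ℝ s) (hne : s.Nonempty) (h0 : (0 : E) ∉ s) :
    ∃ ℓ : StrongDual ℝ E, ℓ ≠ 0 ∧ ∀ x ∈ s, ℓ x ≤ 0 := by
  by_cases hint : (interior s).Nonempty
  · obtain ⟨ℓ, hℓ⟩ := geometric_hahn_banach_open_point hs.interior isOpen_interior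
      (fun h => h0 (interior_subset h))
    rw [map_zero] at hℓ
    obtain ⟨y, hy⟩ := hint
    refine ⟨ℓ, fun h => by simpa [h] using hℓ y hy, fun x hx => ?_⟩
    have hcl : x ∈ closure (interior s) := by
      rw [hs.closure_interior_eq_closure_of_nonempty_interior ⟨y, hy⟩]
      exact subset_closure hx
    exact closure_minimal (fun z hz => (hℓ z hz).le) (isClosed_Iic.preimage ℓ.continuous) hcl
  · -- The set lies in a hyperplane; the functional defining it has constant sign on the set.
    have hspan : vectorSpan ℝ s < ⊤ := by
      rw [lt_top_iff_ne_top, Ne, ← direction_affineSpan]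
      rw [hs.interior_nonempty_iff_affineSpan_eq_top] at hint
      rwa [AffineSubspace.direction_eq_top_iff_of_nonempty ((affineSpan_nonempty ℝ).2 hne)]
    obtain ⟨f, hf0, hf⟩ := Submodule.exists_le_ker_of_lt_top _ hspan
    obtain ⟨y, hy⟩ := hne
    have hconst : ∀ x ∈ s, f x = f y := fun x hx => by
      have := hf (vsub_mem_vectorSpan ℝ hx hy)
      rw [LinearMap.mem_ker, vsub_eq_sub, map_sub] at this
      linarith
    have hne0 : LinearMap.toContinuousLinearMap f ≠ 0 := by simpa using hf0
    rcases le_total (f y) 0 with h | h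
    · exact ⟨LinearMap.toContinuousLinearMap f, hne0, fun x hx => by simpa [hconst x hx] using h⟩
    · exact ⟨-LinearMap.toContinuousLinearMap f, neg_ne_zero.2 hne0,
        fun x hx => by simpa [hconst x hx] using h⟩

/-- Induction on the dimension: if `0 ∉ s`, the integral of a separating functional vanishes, so
the functional itself vanishes almost everywhere and its kernel can replace the space. -/
theorem Convex.zero_mem_of_integral_eq_zero {Ω : Type*} [MeasurableSpace Ω] (μ : Measure Ω)
    [IsProbabilityMeasure μ] (n : ℕ) : ∀ {E : Type*} [NormedAddCommGroup E] [NormedSpace ℝ E]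
    [FiniteDimensional ℝ E], Module.finrank ℝ E = n → ∀ {s : Set E}, Convex ℝ s →
    ∀ {f : Ω → E}, Integrable f μ → (∀ᵐ x ∂μ, f x ∈ s) → ∫ x, f x ∂μ = 0 → (0 : E) ∈ s := by
  induction n using Nat.strong_induction_on with
  | _ n ih =>
    intro E _ _ _ hn s hs f hf hfs hmean
    by_contra h0
    have hne : s.Nonempty := let ⟨x, hx⟩ := hfs.exists; ⟨f x, hx⟩
    obtain ⟨ℓ, hℓ0, hℓ⟩ := hs.exists_dual_le_of_notMem hne h0
    have hint : ∫ x, -ℓ (f x) ∂μ = 0 := by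
      rw [integral_neg, ℓ.integral_comp_comm hf, hmean, map_zero, neg_zero]
    have hker : ∀ᵐ x ∂μ, ℓ (f x) = 0 := by
      have := (integral_eq_zero_iff_of_nonneg_ae
        (hfs.mono fun x hx => neg_nonneg.2 (hℓ _ hx)) (ℓ.integrable_comp hf).neg).1 hint
      exact this.mono fun x hx => by simpa using hx
    set K := LinearMap.ker (ℓ : E →ₗ[ℝ] ℝ) with hK
    obtain ⟨p, hp⟩ := K.subtype.exists_leftInverse_of_injective K.ker_subtype
    have hp' : ∀ x (hx : x ∈ K), p x = ⟨x, hx⟩ := fun x hx =>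
      congrArg (fun φ => φ (⟨x, hx⟩ : K)) hp
    have hlt : Module.finrank ℝ K < n := by
      rw [← hn]
      refine Submodule.finrank_lt (fun h => hℓ0 ?_)
      ext x
      have : x ∈ K := h ▸ Submodule.mem_top
      exact this
    have key := ih _ hlt (E := K) rfl (s := K.subtype ⁻¹' s) (hs.linear_preimage K.subtype)
      (f := fun x => LinearMap.toContinuousLinearMap p (f x))
      ((LinearMap.toContinuousLinearMap p).integrable_comp hf) ?_ ?_
    · exact h0 (by simpa using key)
    · filter_upwards [hfs, hker] with x hx hx'
      simpa [hp' (f x) hx'] using hx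
    · rw [ContinuousLinearMap.integral_comp_comm _ hf, hmean, map_zero]

/-- The mean of an integrable function with values in a convex subset of a finite-dimensional
space lies in that set. Unlike in `Convex.integral_mem`, the set need not be closed. -/
theorem Convex.integral_mem_of_finiteDimensional {Ω : Type*} [MeasurableSpace Ω] {μ : Measure Ω}
    [IsProbabilityMeasure μ] {E : Type*} [NormedAddCommGroup E] [NormedSpace ℝ E]
    [FiniteDimensional ℝ E] {s : Set E} (hs : Convex ℝ s) {f : Ω → E} (hf : Integrable f μ)
    (hfs : ∀ᵐ x ∂μ, f x ∈ s) : ∫ x, f x ∂μ ∈ s := by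
  set m := ∫ x, f x ∂μ with hm
  have key := Convex.zero_mem_of_integral_eq_zero μ _ rfl (hs.translate_preimage_right m)
    (f := fun x => f x - m) (hf.sub (integrable_const m)) (hfs.mono fun x hx => by simpa using hx)
    (by rw [integral_sub hf (integrable_const m)]; simp [hm])
  simpa using key

/-! ### Hyperbolic convexity as convexity in the coordinates `(Re z, |z|²)` -/

/-- The map `z ↦ (Re z, |z|²)`. It sends circles centred on the real axis and vertical lines to
straight lines. -/
noncomputable def kleinMap (z : ℂ) : ℝ × ℝ := (z.re, ‖z‖ ^ 2)

theorem kleinMap_conj (z : ℂ) : kleinMap (conj z) = kleinMap z := by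
  simp [kleinMap]

theorem Complex.norm_sq_eq_re_im (z : ℂ) : ‖z‖ ^ 2 = z.re ^ 2 + z.im ^ 2 := by
  rw [Complex.sq_norm, Complex.normSq_apply]; ring

theorem Complex.norm_sub_ofReal_sq (z : ℂ) (c : ℝ) :
    ‖z - c‖ ^ 2 = ‖z‖ ^ 2 - 2 * c * z.re + c ^ 2 := by
  simp only [Complex.norm_sq_eq_re_im, Complex.sub_re, Complex.sub_im, Complex.ofReal_re,
    Complex.ofReal_im]
  ring

theorem injOn_kleinMap : InjOn kleinMap closedUpperHalfPlane := by
  intro z hz w hw h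
  simp only [kleinMap, Prod.mk.injEq, Complex.norm_sq_eq_re_im] at h
  obtain ⟨h1, h2⟩ := h
  rw [h1] at h2
  exact Complex.ext h1 ((pow_left_inj₀ hz hw two_ne_zero).1 (by linarith))

/-- The inverse of `kleinMap` on the closed upper half plane. -/
noncomputable def kleinInv (q : ℝ × ℝ) : ℂ := ⟨q.1, Real.sqrt (q.2 - q.1 ^ 2)⟩

theorem continuous_kleinInv : Continuous kleinInv := by
  have : kleinInv = fun q : ℝ × ℝ =>
      (q.1 : ℂ) + (Real.sqrt (q.2 - q.1 ^ 2) : ℝ) * Complex.I := by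
    ext q
    exact Complex.mk_eq_add_mul_I _ _
  rw [this]
  fun_prop

theorem kleinInv_mem (q : ℝ × ℝ) : kleinInv q ∈ closedUpperHalfPlane := Real.sqrt_nonneg _

theorem kleinMap_kleinInv {q : ℝ × ℝ} (hq : q.1 ^ 2 ≤ q.2) : kleinMap (kleinInv q) = q := by
  ext
  · rfl
  · simp [kleinMap, kleinInv, Complex.norm_sq_eq_re_im, Real.sq_sqrt (sub_nonneg.2 hq)]

theorem kleinInv_kleinMap {z : ℂ} (hz : z ∈ closedUpperHalfPlane) :
    kleinInv (kleinMap z) = z := by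
  refine injOn_kleinMap (kleinInv_mem _) hz (kleinMap_kleinInv ?_)
  simp only [kleinMap, Complex.norm_sq_eq_re_im]
  linarith [sq_nonneg z.im]

theorem convex_epigraph_sq : Convex ℝ {q : ℝ × ℝ | q.1 ^ 2 ≤ q.2} := by
  have := (even_two.convexOn_pow (𝕜 := ℝ)).convex_epigraph
  simpa using this

theorem kleinMap_mem_epigraph (z : ℂ) : (kleinMap z).1 ^ 2 ≤ (kleinMap z).2 := by
  simp only [kleinMap, Complex.norm_sq_eq_re_im]
  linarith [sq_nonneg z.im]

theorem mem_segment_prod_iff {p₁ p₂ q : ℝ × ℝ} : q ∈ segment ℝ p₁ p₂ ↔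
    ∃ a b : ℝ, 0 ≤ a ∧ 0 ≤ b ∧ a + b = 1 ∧ a * p₁.1 + b * p₂.1 = q.1 ∧
      a * p₁.2 + b * p₂.2 = q.2 := by
  simp only [segment, mem_ofPred_eq, Prod.ext_iff, Prod.fst_add, Prod.snd_add, Prod.smul_fst,
    Prod.smul_snd, smul_eq_mul]

theorem mem_uIcc_iff_exists_combination {x y t : ℝ} :
    t ∈ uIcc x y ↔ ∃ a b : ℝ, 0 ≤ a ∧ 0 ≤ b ∧ a + b = 1 ∧ a * x + b * y = t := by
  rw [← segment_eq_uIcc]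
  simp only [segment, mem_ofPred_eq, smul_eq_mul]

theorem sq_mem_uIcc_sq_iff {x y t : ℝ} (hx : 0 ≤ x) (hy : 0 ≤ y) (ht : 0 ≤ t) :
    t ^ 2 ∈ uIcc (x ^ 2) (y ^ 2) ↔ t ∈ uIcc x y := by
  simp only [mem_uIcc, sq_le_sq₀ hx ht, sq_le_sq₀ hy ht, sq_le_sq₀ ht hx, sq_le_sq₀ ht hy]

/-- The minimal arc is the preimage of a straight segment. -/
theorem mem_arcMin_iff {z₁ z₂ z : ℂ} (h₁ : z₁ ∈ closedUpperHalfPlane)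
    (h₂ : z₂ ∈ closedUpperHalfPlane) :
    z ∈ arcMin z₁ z₂ ↔ z ∈ closedUpperHalfPlane ∧
      kleinMap z ∈ segment ℝ (kleinMap z₁) (kleinMap z₂) := by
  have h₁' : 0 ≤ z₁.im := h₁
  have h₂' : 0 ≤ z₂.im := h₂
  simp only [mem_segment_prod_iff, kleinMap]
  constructor
  · rintro (⟨hre, hz⟩ | ⟨hre, hz, hmem, c, r, e₁, e₂, e⟩)
    · have hzU : z ∈ closedUpperHalfPlane :=
        isHConvex_closedUpperHalfPlane.2 z₁ h₁ z₂ h₂ (Or.inl ⟨hre, hz⟩)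
      refine ⟨hzU, ?_⟩
      obtain ⟨a, b, ha, hb, hab, rfl⟩ := hz
      have him : (a • z₁ + b • z₂).im ∈ uIcc z₁.im z₂.im :=
        mem_uIcc_iff_exists_combination.2 ⟨a, b, ha, hb, hab, by simp⟩
      rw [← sq_mem_uIcc_sq_iff h₁' h₂' hzU, mem_uIcc_iff_exists_combination] at him
      obtain ⟨a', b', ha', hb', hab', h⟩ := him
      refine ⟨a', b', ha', hb', hab', ?_, ?_⟩
      · simp only [Complex.add_re, Complex.real_smul, Complex.re_ofReal_mul, ← hre, ← add_mul,
          hab, hab']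
      · have hre' : (a • z₁ + b • z₂).re = z₁.re := by
          simp only [Complex.add_re, Complex.real_smul, Complex.re_ofReal_mul, ← hre, ← add_mul,
            hab, one_mul]
        rw [Complex.norm_sq_eq_re_im, Complex.norm_sq_eq_re_im, Complex.norm_sq_eq_re_im, hre',
          ← h, ← hre]
        linear_combination z₁.re ^ 2 * hab'
    · refine ⟨hz, ?_⟩
      obtain ⟨a, b, ha, hb, hab, h⟩ := mem_uIcc_iff_exists_combination.1 hmem
      refine ⟨a, b, ha, hb, hab, h, ?_⟩
      have f₁ := Complex.norm_sub_ofReal_sq z₁ c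
      have f₂ := Complex.norm_sub_ofReal_sq z₂ c
      have f := Complex.norm_sub_ofReal_sq z c
      rw [e₁] at f₁
      rw [e₂] at f₂
      rw [e] at f
      linear_combination f - a * f₁ - b * f₂ + 2 * c * h + (r ^ 2 - c ^ 2) * hab
  · rintro ⟨hz, a, b, ha, hb, hab, hre, hn⟩
    by_cases hre12 : z₁.re = z₂.re
    · left
      have hzre : z.re = z₁.re := by rw [← hre, ← hre12, ← add_mul, hab, one_mul]
      refine ⟨hre12, ?_⟩
      have him : z.im ^ 2 ∈ uIcc (z₁.im ^ 2) (z₂.im ^ 2) := by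
        refine mem_uIcc_iff_exists_combination.2 ⟨a, b, ha, hb, hab, ?_⟩
        rw [Complex.norm_sq_eq_re_im, Complex.norm_sq_eq_re_im, Complex.norm_sq_eq_re_im, hzre,
          ← hre12] at hn
        linear_combination hn - z₁.re ^ 2 * hab
      rw [sq_mem_uIcc_sq_iff h₁' h₂' hz, mem_uIcc_iff_exists_combination] at him
      obtain ⟨a', b', ha', hb', hab', h⟩ := him
      refine ⟨a', b', ha', hb', hab', Complex.ext ?_ ?_⟩
      · simp only [Complex.add_re, Complex.real_smul, Complex.re_ofReal_mul, ← hre12, ← add_mul,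
          hab', one_mul, hzre]
      · simpa using h
    · right
      have hne : z₁.re - z₂.re ≠ 0 := sub_ne_zero.2 hre12
      -- The centre of the circle is determined by the two end points.
      obtain ⟨c, hc⟩ : ∃ c : ℝ, 2 * c * (z₁.re - z₂.re) = ‖z₁‖ ^ 2 - ‖z₂‖ ^ 2 :=
        ⟨(‖z₁‖ ^ 2 - ‖z₂‖ ^ 2) / (2 * (z₁.re - z₂.re)), by field_simp⟩
      refine ⟨hre12, hz, mem_uIcc_iff_exists_combination.2 ⟨a, b, ha, hb, hab, hre⟩, c,
        ‖z₁ - c‖, rfl, ?_, ?_⟩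
      · rw [← pow_left_inj₀ (norm_nonneg _) (norm_nonneg _) two_ne_zero,
          Complex.norm_sub_ofReal_sq, Complex.norm_sub_ofReal_sq]
        linear_combination hc
      · rw [← pow_left_inj₀ (norm_nonneg _) (norm_nonneg _) two_ne_zero,
          Complex.norm_sub_ofReal_sq, Complex.norm_sub_ofReal_sq]
        obtain rfl : a = 1 - b := by linarith
        linear_combination b * hc + 2 * c * hre - hn

theorem hConvexHull_eq {P : Set ℂ} (hP : P ⊆ closedUpperHalfPlane) :
    hConvexHull P = {z | z ∈ closedUpperHalfPlane ∧ kleinMap z ∈ convexHull ℝ (kleinMap '' P)} := by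
  apply Subset.antisymm
  · apply sInter_subset_of_mem
    refine ⟨⟨fun z hz => hz.1, fun z₁ h₁ z₂ h₂ z hz => ?_⟩, fun z hz =>
      ⟨hP hz, subset_convexHull ℝ _ (mem_image_of_mem _ hz)⟩⟩
    have := (mem_arcMin_iff h₁.1 h₂.1).1 hz
    exact ⟨this.1, (convex_convexHull ℝ _).segment_subset h₁.2 h₂.2 this.2⟩
  · rintro z ⟨hz, hzm⟩ S ⟨⟨hSU, hS⟩, hPS⟩
    have hconv : Convex ℝ (kleinMap '' S) := by
      rw [convex_iff_segment_subset]
      rintro _ ⟨z₁, h₁, rfl⟩ _ ⟨z₂, h₂, rfl⟩ q hq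
      have hqe : q.1 ^ 2 ≤ q.2 := convex_epigraph_sq.segment_subset
        (kleinMap_mem_epigraph z₁) (kleinMap_mem_epigraph z₂) hq
      refine ⟨kleinInv q, hS z₁ h₁ z₂ h₂ ?_, kleinMap_kleinInv hqe⟩
      rw [mem_arcMin_iff (hSU h₁) (hSU h₂), kleinMap_kleinInv hqe]
      exact ⟨kleinInv_mem q, hq⟩
    obtain ⟨w, hw, hwz⟩ := convexHull_min (image_mono hPS) hconv hzm
    rwa [injOn_kleinMap hz (hSU hw) hwz.symm]

/-! ### The scaled relative graph in the coordinates `(Re z, |z|²)` -/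

section Hilbert

variable {H : Type*} [NormedAddCommGroup H] [InnerProductSpace ℂ H]

/-- The coordinates `(Re z, |z|²)` of the point of the scaled relative graph that belongs to an
input increment `x` and an output increment `y`. -/
noncomputable def srgCoord (x y : H) : ℝ × ℝ :=
  ((inner ℂ x y).re / ‖x‖ ^ 2, ‖y‖ ^ 2 / ‖x‖ ^ 2)

theorem srgPoint_eq_kleinInv (R : H → H) (u₁ u₂ : H) :
    srgPoint R u₁ u₂ = kleinInv (srgCoord (u₁ - u₂) (R u₁ - R u₂)) := by
  simp only [srgPoint, hilbertAngle, kleinInv, srgCoord]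
  generalize u₁ - u₂ = x
  generalize R u₁ - R u₂ = y
  rw [mul_comm Complex.I]
  have hc : |(inner ℂ x y).re| ≤ ‖x‖ * ‖y‖ :=
    (Complex.abs_re_le_norm _).trans (norm_inner_le_norm x y)
  -- If `x = 0` or `y = 0`, both sides are `0`, by the conventions for division by zero.
  rcases eq_or_ne x 0 with rfl | hx
  · apply Complex.ext <;> simp
  rcases eq_or_ne y 0 with rfl | hy
  · apply Complex.ext <;> simp
  have hx' : 0 < ‖x‖ := norm_pos_iff.2 hx
  have hy' : 0 < ‖y‖ := norm_pos_iff.2 hy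
  have hxy : 0 < ‖x‖ * ‖y‖ := mul_pos hx' hy'
  rw [abs_le] at hc
  apply Complex.ext
  · rw [Complex.re_ofReal_mul, Complex.exp_ofReal_mul_I_re, Real.cos_arccos]
    · field_simp
    · rw [le_div_iff₀ hxy]; linarith
    · rw [div_le_one hxy]; exact hc.2
  · rw [Complex.im_ofReal_mul, Complex.exp_ofReal_mul_I_im, Real.sin_arccos,
      ← Real.sqrt_sq (div_nonneg hy'.le hx'.le), ← Real.sqrt_mul (sq_nonneg _)]
    congr 1
    field_simp

theorem srgPoint_mem_closedUpperHalfPlane (R : H → H) (u₁ u₂ : H) :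
    srgPoint R u₁ u₂ ∈ closedUpperHalfPlane := by
  rw [srgPoint_eq_kleinInv]
  exact kleinInv_mem _

theorem srgCoord_smul {c : ℝ} (hc : c ≠ 0) (x y : H) :
    srgCoord ((c : ℂ) • x) ((c : ℂ) • y) = srgCoord x y := by
  simp only [srgCoord, inner_smul_left, inner_smul_right, norm_smul, Complex.conj_ofReal,
    Complex.norm_real, Real.norm_eq_abs, mul_pow, sq_abs, Complex.re_ofReal_mul]
  ext
  · rw [← mul_assoc, ← sq, mul_div_mul_left _ _ (pow_ne_zero 2 hc)]
  · exact mul_div_mul_left _ _ (pow_ne_zero 2 hc)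

theorem tendsto_srgCoord {ι : Type*} {l : Filter ι} {x y : ι → H} {p A B : ℝ}
    (hp : p ≠ 0) (hx : Tendsto (fun i => ‖x i‖ ^ 2) l (𝓝 p))
    (hxy : Tendsto (fun i => (inner ℂ (x i) (y i)).re) l (𝓝 A))
    (hy : Tendsto (fun i => ‖y i‖ ^ 2) l (𝓝 B)) :
    Tendsto (fun i => srgCoord (x i) (y i)) l (𝓝 (A / p, B / p)) :=
  (hxy.div hx hp).prodMk_nhds (hy.div hx hp)

/-- Inner products of bounded families are insensitive to perturbations that tend to zero. -/
theorem tendsto_inner_add_of_bounded {ι : Type*} {l : Filter ι} {p q r r' : ι → H} {M : ℝ} {L : ℂ}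
    (hp : ∀ᶠ i in l, ‖p i‖ ≤ M) (hq : ∀ᶠ i in l, ‖q i‖ ≤ M) (hr : Tendsto r l (𝓝 0))
    (hr' : Tendsto r' l (𝓝 0)) (h : Tendsto (fun i => inner ℂ (p i) (q i)) l (𝓝 L)) :
    Tendsto (fun i => inner ℂ (p i + r i) (q i + r' i)) l (𝓝 L) := by
  have e : (fun i => inner ℂ (p i + r i) (q i + r' i)) = fun i =>
      inner ℂ (p i) (q i) + (inner ℂ (p i) (r' i) + (inner ℂ (r i) (q i) +
        inner ℂ (r i) (r' i))) := by
    ext i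
    simp only [inner_add_left, inner_add_right]
    ring
  rw [e]
  have h1 : Tendsto (fun i => inner ℂ (p i) (r' i)) l (𝓝 0) := by
    refine squeeze_zero_norm' (a := fun i => M * ‖r' i‖) (hp.mono fun i hi => ?_) ?_
    · exact (norm_inner_le_norm _ _).trans (by gcongr)
    · simpa using hr'.norm.const_mul M
  have h2 : Tendsto (fun i => inner ℂ (r i) (q i)) l (𝓝 0) := by
    refine squeeze_zero_norm' (a := fun i => ‖r i‖ * M) (hq.mono fun i hi => ?_) ?_
    · exact (norm_inner_le_norm _ _).trans (by gcongr)
    · simpa using hr.norm.mul_const M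
  have h3 : Tendsto (fun i => inner ℂ (r i) (r' i)) l (𝓝 0) := by
    simpa using hr.inner hr' (𝕜 := ℂ)
  simpa using h.add (h1.add (h2.add h3))

/-- Let the family `e ω` be asymptotically orthonormal and let `g` act on it asymptotically as
multiplication by `c ω`. Then, on inputs asymptotic to `∑ a ω • e ω`, the coordinates of the scaled
relative graph converge to the mean of `(Re c ω, |c ω|²)` with weights `|a ω|²`. -/
theorem tendsto_srgCoord_of_asymptotically_orthonormal {ι κ : Type*} [DecidableEq κ] {l : Filter ι}
    {e f : κ → ι → H} (s : Finset κ) (a c : κ → ℂ) (he : ∀ k, ∀ᶠ i in l, ‖e k i‖ ≤ 1)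
    (horth : ∀ k k', Tendsto (fun i => inner ℂ (e k i) (e k' i)) l (𝓝 (if k = k' then 1 else 0)))
    (hf : ∀ k, Tendsto (fun i => f k i - c k • e k i) l (𝓝 0)) {r r' : ι → H}
    (hr : Tendsto r l (𝓝 0)) (hr' : Tendsto r' l (𝓝 0)) (ha : ∑ k ∈ s, ‖a k‖ ^ 2 ≠ 0) :
    Tendsto (fun i => ‖∑ k ∈ s, a k • e k i + r i‖ ^ 2) l (𝓝 (∑ k ∈ s, ‖a k‖ ^ 2)) ∧
    Tendsto (fun i => srgCoord (∑ k ∈ s, a k • e k i + r i) (∑ k ∈ s, a k • f k i + r' i)) l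
      (𝓝 (∑ k ∈ s, (‖a k‖ ^ 2 / ∑ k ∈ s, ‖a k‖ ^ 2) • kleinMap (c k))) := by
  have hbdd : ∀ b : κ → ℂ, ∀ᶠ i in l, ‖∑ k ∈ s, b k • e k i‖ ≤ ∑ k ∈ s, ‖b k‖ := fun b => by
    filter_upwards [(Filter.eventually_all_finset s).2 fun k _ => he k] with i hi
    refine norm_sum_le_of_le _ fun k hk => ?_
    rw [norm_smul]
    exact mul_le_of_le_one_right (norm_nonneg _) (hi k hk)
  have hinner : ∀ b b' : κ → ℂ, Tendsto
      (fun i => inner ℂ (∑ k ∈ s, b k • e k i) (∑ k ∈ s, b' k • e k i)) l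
      (𝓝 (∑ k ∈ s, conj (b k) * b' k)) := fun b b' => by
    have hexp : ∀ i, inner ℂ (∑ k ∈ s, b k • e k i) (∑ k ∈ s, b' k • e k i) =
        ∑ k ∈ s, ∑ k' ∈ s, conj (b k) * (b' k' * inner ℂ (e k i) (e k' i)) := fun i => by
      rw [sum_inner]
      simp only [inner_smul_left, inner_sum, inner_smul_right]
      exact Finset.sum_congr rfl fun _ _ => Finset.sum_congr rfl fun _ _ => mul_left_comm _ _ _
    simp only [hexp]
    have := tendsto_finsetSum s fun k _ => tendsto_finsetSum s fun k' _ =>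
      ((horth k k').const_mul (b' k')).const_mul (conj (b k))
    convert this using 2
    refine Finset.sum_congr rfl fun k hk => ?_
    simp [hk]
  have hinner' : ∀ b b' : κ → ℂ, ∀ {r r' : ι → H}, Tendsto r l (𝓝 0) → Tendsto r' l (𝓝 0) →
      Tendsto (fun i => inner ℂ (∑ k ∈ s, b k • e k i + r i) (∑ k ∈ s, b' k • e k i + r' i)) l
      (𝓝 (∑ k ∈ s, conj (b k) * b' k)) := fun b b' r r' hr hr' =>
    tendsto_inner_add_of_bounded (M := max (∑ k ∈ s, ‖b k‖) (∑ k ∈ s, ‖b' k‖))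
      ((hbdd b).mono fun i hi => hi.trans (le_max_left _ _))
      ((hbdd b').mono fun i hi => hi.trans (le_max_right _ _)) hr hr' (hinner b b')
  have hnorm : ∀ b : κ → ℂ, ∀ {r : ι → H}, Tendsto r l (𝓝 0) →
      Tendsto (fun i => ‖∑ k ∈ s, b k • e k i + r i‖ ^ 2) l (𝓝 (∑ k ∈ s, ‖b k‖ ^ 2)) :=
    fun b r hr => by
    have := (Complex.continuous_re.tendsto _).comp (hinner' b b hr hr)
    convert this using 2
    · exact (inner_self_eq_norm_sq (𝕜 := ℂ) _).symm
    · rw [Complex.re_sum]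
      refine Finset.sum_congr rfl fun k _ => ?_
      rw [Complex.conj_mul', ← Complex.ofReal_pow, Complex.ofReal_re]
  refine ⟨hnorm a hr, ?_⟩
  have hr'' : Tendsto (fun i => ∑ k ∈ s, a k • (f k i - c k • e k i) + r' i) l (𝓝 0) := by
    simpa using (tendsto_finsetSum s fun k _ => (hf k).const_smul (a k)).add hr'
  have hy : (fun i => ∑ k ∈ s, a k • f k i + r' i) = fun i =>
      ∑ k ∈ s, (a k * c k) • e k i + (∑ k ∈ s, a k • (f k i - c k • e k i) + r' i) := by
    ext i
    rw [← add_assoc, ← Finset.sum_add_distrib]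
    congr 1
    refine Finset.sum_congr rfl fun k _ => ?_
    rw [smul_sub, smul_smul]
    abel
  have key := tendsto_srgCoord ha (hnorm a hr)
    ((Complex.continuous_re.tendsto _).comp (hinner' a (fun k => a k * c k) hr hr''))
    (hnorm (fun k => a k * c k) hr'')
  have hy' := fun i => congrFun hy i
  simp only [hy']
  convert key using 2
  ext
  · rw [Complex.re_sum, Prod.fst_sum, Finset.sum_div]
    refine Finset.sum_congr rfl fun k _ => ?_
    rw [← mul_assoc, Complex.conj_mul', ← Complex.ofReal_pow, Complex.re_ofReal_mul]
    simp only [kleinMap, Prod.smul_fst, smul_eq_mul]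
    ring
  · rw [Prod.snd_sum, Finset.sum_div]
    refine Finset.sum_congr rfl fun k _ => ?_
    simp only [kleinMap, Prod.smul_snd, smul_eq_mul, norm_mul]
    ring

end Hilbert

/-! ### The Fourier transform of square-integrable signals -/

theorem SignalL2.norm_sq_eq_integral (u : SignalL2) : ‖u‖ ^ 2 = ∫ ξ, ‖(u : ℝ → ℂ) ξ‖ ^ 2 := by
  have h : ((‖u‖ ^ 2 : ℝ) : ℂ) = ((∫ ξ, ‖(u : ℝ → ℂ) ξ‖ ^ 2 : ℝ) : ℂ) := by
    rw [← integral_complex_ofReal, Complex.ofReal_pow]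
    refine (inner_self_eq_norm_sq_to_K (𝕜 := ℂ) u).symm.trans ?_
    rw [L2.inner_def]
    refine integral_congr_ae (Eventually.of_forall fun ξ => ?_)
    change inner ℂ _ _ = _
    rw [inner_self_eq_norm_sq_to_K]
    exact (Complex.ofReal_pow _ _).symm
  exact_mod_cast h

theorem SignalL2.integrable_norm_sq (u : SignalL2) :
    Integrable fun ξ => ‖(u : ℝ → ℂ) ξ‖ ^ 2 :=
  (Lp.memLp u).integrable_norm_pow two_ne_zero

/-- On `L¹ ∩ L²` the Fourier transform of `L²` is given by the Fourier integral: both define the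
same tempered distribution. -/
theorem fourier_toLp_ae_eq {f : ℝ → ℂ} (hf : MemLp f 2 (volume : Measure ℝ)) (hf1 : Integrable f) :
    ((𝓕 (hf.toLp f) : SignalL2) : ℝ → ℂ) =ᵐ[volume] 𝓕 f := by
  have hcont : Continuous (𝓕 f) :=
    VectorFourier.fourierIntegral_continuous Real.continuous_fourierChar
      continuous_inner hf1
  refine ae_eq_of_integral_contDiff_smul_eq
    ((Lp.memLp (𝓕 (hf.toLp f) : SignalL2)).locallyIntegrable one_le_two)
    hcont.locallyIntegrable fun φ hφ hφc => ?_
  have hg₁ : HasCompactSupport (Complex.ofRealCLM ∘ φ) := hφc.comp_left rfl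
  have hg₂ : ContDiff ℝ (⊤ : ℕ∞) (Complex.ofRealCLM ∘ φ) := by fun_prop
  set ψ : SchwartzMap ℝ ℂ := hg₁.toSchwartzMap hg₂ with hψ
  have hψφ : ∀ x, ψ x = (φ x : ℂ) := fun x => rfl
  have h1 := congrArg (fun D => D ψ) (Lp.fourier_toTemperedDistribution_eq (hf.toLp f))
  simp only [TemperedDistribution.fourier_apply, Lp.toTemperedDistribution_apply] at h1
  have h2 := VectorFourier.integral_fourierIntegral_smul_eq_flip (L := innerₗ ℝ) (μ := volume)
    (ν := volume) (f := (ψ : ℝ → ℂ)) (g := f) Real.continuous_fourierChar continuous_inner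
    ψ.integrable hf1
  calc ∫ x, φ x • ((𝓕 (hf.toLp f) : SignalL2) : ℝ → ℂ) x
      = ∫ x, ψ x • ((𝓕 (hf.toLp f) : SignalL2) : ℝ → ℂ) x := by simp [hψφ]
    _ = ∫ x, (𝓕 ψ) x • (hf.toLp f : ℝ → ℂ) x := h1.symm
    _ = ∫ x, (𝓕 ψ) x • f x := by
        refine integral_congr_ae ?_
        filter_upwards [hf.coeFn_toLp] with x hx
        rw [hx]
    _ = ∫ x, ψ x • (𝓕 f) x := by
        simp only [SchwartzMap.fourier_coe]
        refine h2.trans ?_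
        simp only [flip_innerₗ]
        rfl
    _ = _ := by simp [hψφ]

/-! ### Convolution operators as multipliers -/

section Multiplier

variable {g : SignalL2 →ₗ[ℂ] SignalL2} {m : ℝ → ℂ}

/-- A linear operator on `L²` that is a Fourier multiplier is continuous, by the closed graph
theorem. -/
theorem continuous_of_multiplier
    (hm : ∀ u : SignalL2, ((𝓕 (g u) : SignalL2) : ℝ → ℂ) =ᵐ[volume]
      fun ξ => m ξ * ((𝓕 u : SignalL2) : ℝ → ℂ) ξ) : Continuous g := by
  refine g.continuous_of_seq_closed_graph fun u x y hu hgu => ?_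
  apply (Lp.fourierTransformₗᵢ ℝ ℂ).injective
  have hc := (Lp.fourierTransformₗᵢ ℝ ℂ).continuous
  have h1 : Tendsto (fun n => (𝓕 (u n) : SignalL2)) atTop (𝓝 (𝓕 x)) := (hc.tendsto x).comp hu
  -- Along a subsequence both transforms converge almost everywhere.
  obtain ⟨ns, hns, hlim⟩ := (tendstoInMeasure_of_tendsto_Lp h1).exists_seq_tendsto_ae
  have h2 : Tendsto (fun n => (𝓕 (g (u (ns n))) : SignalL2)) atTop (𝓝 (𝓕 y)) :=
    ((hc.tendsto y).comp hgu).comp hns.tendsto_atTop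
  obtain ⟨ns', hns', hlim'⟩ := (tendstoInMeasure_of_tendsto_Lp h2).exists_seq_tendsto_ae
  refine Lp.ext ?_
  change ((𝓕 y : SignalL2) : ℝ → ℂ) =ᵐ[volume] ((𝓕 (g x) : SignalL2) : ℝ → ℂ)
  filter_upwards [hlim, hlim', hm x, ae_all_iff.2 fun n => hm (u n)] with ξ a1 a2 a3 a4
  rw [a3]
  refine tendsto_nhds_unique a2 ?_
  simp only [a4]
  exact (a1.comp hns'.tendsto_atTop).const_mul (m ξ)

/-- The point of the scaled relative graph that belongs to `x ≠ 0` is the mean of the curve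
`ξ ↦ (Re m ξ, |m ξ|²)` with respect to the energy density of `x`. -/
theorem srgCoord_mem_convexHull
    (hm : ∀ u : SignalL2, ((𝓕 (g u) : SignalL2) : ℝ → ℂ) =ᵐ[volume]
      fun ξ => m ξ * ((𝓕 u : SignalL2) : ℝ → ℂ) ξ) {x : SignalL2} (hx : x ≠ 0) :
    srgCoord x (g x) ∈ convexHull ℝ (kleinMap '' range m) := by
  set X : SignalL2 := 𝓕 x with hX
  have hXx : ‖X‖ = ‖x‖ := Lp.norm_fourier_eq x
  have hpos : 0 < ‖x‖ ^ 2 := pow_pos (norm_pos_iff.2 hx) 2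
  -- The normalized energy density of `x`.
  set w : ℝ → NNReal := fun ξ => ‖(X : ℝ → ℂ) ξ‖₊ ^ 2 / ‖x‖₊ ^ 2 with hw
  have hwm : Measurable w := by
    have := (Lp.stronglyMeasurable X).measurable
    fun_prop
  have hwr : ∀ ξ, (w ξ : ℝ) = ‖(X : ℝ → ℂ) ξ‖ ^ 2 / ‖x‖ ^ 2 := fun ξ => by simp [hw]
  set μ : Measure ℝ := volume.withDensity fun ξ => (w ξ : ENNReal) with hμ
  have hwi : Integrable fun ξ => (w ξ : ℝ) := by
    simp only [hwr]
    exact (SignalL2.integrable_norm_sq X).div_const _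
  have hw1 : ∫ ξ, (w ξ : ℝ) = 1 := by
    simp only [hwr]
    rw [integral_div, ← SignalL2.norm_sq_eq_integral, hXx, div_self hpos.ne']
  have : IsProbabilityMeasure μ := by
    constructor
    rw [hμ, withDensity_apply _ MeasurableSet.univ, Measure.restrict_univ]
    have := ofReal_integral_eq_lintegral_ofReal hwi (Eventually.of_forall fun ξ => (w ξ).2)
    rw [hw1, ENNReal.ofReal_one] at this
    rw [this]
    simp
  have hY : ∀ᵐ ξ, ((𝓕 (g x) : SignalL2) : ℝ → ℂ) ξ = m ξ * (X : ℝ → ℂ) ξ := hm x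
  have hre : ∀ᵐ ξ, (inner ℂ ((X : ℝ → ℂ) ξ) (((𝓕 (g x) : SignalL2) : ℝ → ℂ) ξ)).re =
      (m ξ).re * ‖(X : ℝ → ℂ) ξ‖ ^ 2 := by
    filter_upwards [hY] with ξ h
    rw [h, RCLike.inner_apply, mul_assoc, Complex.mul_conj', ← Complex.ofReal_pow,
      Complex.re_mul_ofReal]
  have hnm : ∀ᵐ ξ, ‖((𝓕 (g x) : SignalL2) : ℝ → ℂ) ξ‖ ^ 2 =
      ‖m ξ‖ ^ 2 * ‖(X : ℝ → ℂ) ξ‖ ^ 2 := by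
    filter_upwards [hY] with ξ h
    rw [h, norm_mul, mul_pow]
  have hii : Integrable fun ξ =>
      (inner ℂ ((X : ℝ → ℂ) ξ) (((𝓕 (g x) : SignalL2) : ℝ → ℂ) ξ)) := L2.integrable_inner _ _
  have hi1 : Integrable fun ξ => w ξ • (m ξ).re := by
    have : Integrable fun ξ => (inner ℂ ((X : ℝ → ℂ) ξ)
        (((𝓕 (g x) : SignalL2) : ℝ → ℂ) ξ)).re / ‖x‖ ^ 2 := hii.re.div_const _
    refine this.congr ?_
    filter_upwards [hre] with ξ h
    rw [h, NNReal.smul_def, hwr, smul_eq_mul]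
    ring
  have hi2 : Integrable fun ξ => w ξ • ‖m ξ‖ ^ 2 := by
    refine ((SignalL2.integrable_norm_sq (𝓕 (g x))).div_const (‖x‖ ^ 2)).congr ?_
    filter_upwards [hnm] with ξ h
    rw [h, NNReal.smul_def, hwr, smul_eq_mul]
    ring
  have hint : Integrable (fun ξ => kleinMap (m ξ)) μ := by
    rw [hμ, integrable_withDensity_iff_integrable_smul hwm]
    exact hi1.prodMk hi2
  have e1 : ∫ ξ, w ξ • (m ξ).re = (inner ℂ x (g x)).re / ‖x‖ ^ 2 := by
    rw [← Lp.inner_fourier_eq, L2.inner_def]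
    have := integral_re hii
    change _ = Complex.re _ at this
    rw [← this, ← integral_div]
    refine integral_congr_ae ?_
    filter_upwards [hre] with ξ h
    change _ = Complex.re _ / _
    rw [h, NNReal.smul_def, hwr, smul_eq_mul]
    ring
  have e2 : ∫ ξ, w ξ • ‖m ξ‖ ^ 2 = ‖g x‖ ^ 2 / ‖x‖ ^ 2 := by
    rw [← Lp.norm_fourier_eq (g x), SignalL2.norm_sq_eq_integral, ← integral_div]
    refine integral_congr_ae ?_
    filter_upwards [hnm] with ξ h
    rw [h, NNReal.smul_def, hwr, smul_eq_mul]
    ring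
  have key := (convex_convexHull ℝ (kleinMap '' range m)).integral_mem_of_finiteDimensional hint
    (Eventually.of_forall fun ξ =>
      subset_convexHull ℝ _ (mem_image_of_mem _ (mem_range_self ξ)))
  rw [hμ, integral_withDensity_eq_integral_smul hwm] at key
  have : ∫ ξ, w ξ • kleinMap (m ξ) = srgCoord x (g x) := by
    have h := integral_pair hi1 hi2
    rw [e1, e2] at h
    exact h
  rwa [this] at key

end Multiplier

/-! ### Windowed sinusoids -/

/-- The complex sinusoid of angular frequency `ω`, truncated to the window `[-T, T]`. -/
noncomputable def windowedSinusoid (ω T : ℝ) : SignalL2 :=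
  (memLp_truncated_sinusoids (Finsupp.single ω 1) T).toLp _

theorem sinusoids_single (ω t : ℝ) :
    sinusoids (Finsupp.single ω 1) t = Complex.exp (Complex.I * ω * t) := by
  simp [sinusoids]

theorem coeFn_windowedSinusoid (ω T : ℝ) : (windowedSinusoid ω T : ℝ → ℂ) =ᵐ[volume]
    (Icc (-T) T).indicator fun t => Complex.exp (Complex.I * ω * t) := by
  refine (MemLp.coeFn_toLp _).trans (Eventually.of_forall fun t => ?_)
  simp only [indicator, sinusoids_single]

theorem truncatedInput_eq (s : (ℝ →₀ ℂ) × SignalL2) (T : ℝ) {S : Finset ℝ} (hS : s.1.support ⊆ S) :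
    truncatedInput s T = ∑ ω ∈ S, s.1 ω • windowedSinusoid ω T + s.2 := by
  rw [truncatedInput]
  congr 1
  refine Lp.ext ?_
  refine (MemLp.coeFn_toLp _).trans ?_
  refine EventuallyEq.trans ?_ (Lp.coeFn_finsetSum _ _).symm
  have h : ∀ᵐ t : ℝ, ∀ ω ∈ S, ((s.1 ω • windowedSinusoid ω T : SignalL2) : ℝ → ℂ) t =
      s.1 ω • (Icc (-T) T).indicator (fun t : ℝ => Complex.exp (Complex.I * ω * t)) t := by
    rw [Filter.eventually_all_finset]
    intro ω _
    filter_upwards [Lp.coeFn_smul (s.1 ω) (windowedSinusoid ω T), coeFn_windowedSinusoid ω T]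
      with t h1 h2
    rw [h1, Pi.smul_apply, h2]
  filter_upwards [h] with t ht
  rw [Finset.sum_apply, Finset.sum_congr rfl ht]
  by_cases hmem : t ∈ Icc (-T) T
  · simp only [indicator_of_mem hmem, sinusoids, smul_eq_mul]
    refine Finset.sum_subset hS fun ω _ hω => ?_
    rw [Finsupp.notMem_support_iff.1 hω, zero_mul]
  · simp [indicator_of_notMem hmem]

theorem integral_exp_window_eq (s T : ℝ) (hT : 0 ≤ T) :
    ∫ t, (Icc (-T) T).indicator (fun t : ℝ => Complex.exp (Complex.I * s * t)) t =
      ∫ t in (-T)..T, Complex.exp (Complex.I * s * t) := by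
  rw [integral_indicator measurableSet_Icc, integral_Icc_eq_integral_Ioc,
    intervalIntegral.integral_of_le (by linarith)]

theorem norm_integral_exp_window_le {s : ℝ} (hs : s ≠ 0) {T : ℝ} (hT : 0 ≤ T) :
    ‖∫ t, (Icc (-T) T).indicator (fun t : ℝ => Complex.exp (Complex.I * s * t)) t‖ ≤ 2 / |s| := by
  have hc : Complex.I * (s : ℂ) ≠ 0 := mul_ne_zero Complex.I_ne_zero (Complex.ofReal_ne_zero.2 hs)
  rw [integral_exp_window_eq s T hT, integral_exp_mul_complex hc, norm_div, norm_mul,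
    Complex.norm_I, one_mul, Complex.norm_real, Real.norm_eq_abs]
  gcongr
  have h : ∀ t : ℝ, ‖Complex.exp (Complex.I * s * t)‖ = 1 := fun t => by
    rw [show Complex.I * (s : ℂ) * t = ((s * t : ℝ) : ℂ) * Complex.I by push_cast; ring]
    exact Complex.norm_exp_ofReal_mul_I _
  refine (norm_sub_le _ _).trans ?_
  rw [h, h]
  norm_num

theorem inner_windowedSinusoid (ω ω' T : ℝ) :
    inner ℂ (windowedSinusoid ω T) (windowedSinusoid ω' T) =
      ∫ t, (Icc (-T) T).indicator (fun t : ℝ => Complex.exp (Complex.I * (ω' - ω : ℝ) * t)) t := by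
  rw [L2.inner_def]
  refine integral_congr_ae ?_
  filter_upwards [coeFn_windowedSinusoid ω T, coeFn_windowedSinusoid ω' T] with t h1 h2
  rw [h1, h2]
  by_cases hmem : t ∈ Icc (-T) T
  · simp only [indicator_of_mem hmem, RCLike.inner_apply, ← Complex.exp_conj, ← Complex.exp_add]
    congr 1
    simp only [map_mul, Complex.conj_I, Complex.conj_ofReal, Complex.ofReal_sub]
    ring
  · simp [indicator_of_notMem hmem]

theorem norm_sq_windowedSinusoid (ω : ℝ) {T : ℝ} (hT : 0 ≤ T) :
    ‖windowedSinusoid ω T‖ ^ 2 = 2 * T := by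
  have h := inner_windowedSinusoid ω ω T
  rw [integral_exp_window_eq _ T hT] at h
  simp only [sub_self, Complex.ofReal_zero, mul_zero, zero_mul, Complex.exp_zero,
    intervalIntegral.integral_const, sub_neg_eq_add] at h
  have h2 := inner_self_eq_norm_sq (𝕜 := ℂ) (windowedSinusoid ω T)
  rw [h] at h2
  rw [← h2]
  simp
  ring

/-- The Fourier transform of a windowed sinusoid decays away from its frequency, uniformly in the
length of the window. -/
theorem norm_fourier_windowedSinusoid_le (ω : ℝ) {T : ℝ} (hT : 0 ≤ T) :
    ∀ᵐ ξ : ℝ, ω ≠ 2 * Real.pi * ξ →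
      ‖((𝓕 (windowedSinusoid ω T) : SignalL2) : ℝ → ℂ) ξ‖ ≤ 2 / |ω - 2 * Real.pi * ξ| := by
  have hint : Integrable ((Icc (-T) T).indicator (sinusoids (Finsupp.single ω 1))) := by
    rw [integrable_indicator_iff measurableSet_Icc]
    exact (continuous_sinusoids _).continuousOn.integrableOn_compact isCompact_Icc
  filter_upwards [fourier_toLp_ae_eq (memLp_truncated_sinusoids (Finsupp.single ω 1) T) hint]
    with ξ hξ hne
  rw [windowedSinusoid, hξ, Real.fourier_real_eq_integral_exp_smul]
  refine le_of_eq_of_le ?_ (norm_integral_exp_window_le (sub_ne_zero.2 hne) hT)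
  congr 2
  ext t
  by_cases hmem : t ∈ Icc (-T) T
  · simp only [indicator_of_mem hmem, sinusoids_single, smul_eq_mul, ← Complex.exp_add]
    congr 1
    push_cast
    ring
  · simp [indicator_of_notMem hmem]

/-- The part of the energy of a windowed sinusoid that lies away from its frequency is bounded,
uniformly in the length of the window. -/
theorem exists_bound_fourier_windowedSinusoid (ω : ℝ) {δ : ℝ} (hδ : 0 < δ) :
    ∃ M : ℝ, ∀ T : ℝ, 0 ≤ T → ∀ v : SignalL2,
      ((v : ℝ → ℂ) =ᵐ[volume] {ξ : ℝ | δ ≤ |ω - 2 * Real.pi * ξ|}.indicator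
        ((𝓕 (windowedSinusoid ω T) : SignalL2) : ℝ → ℂ)) → ‖v‖ ≤ M := by
  -- An integrable majorant of `4 / (ω - 2πξ)²` on the region `δ ≤ |ω - 2πξ|`.
  set b : ℝ → ℝ := fun ξ => 4 * (1 + 1 / δ ^ 2) * (1 + (ω - 2 * Real.pi * ξ) ^ 2)⁻¹ with hb
  have hbi : Integrable b := by
    refine Integrable.const_mul ?_ _
    have := (integrable_inv_one_add_sq.comp_sub_left ω).comp_mul_left'
      (R := 2 * Real.pi) (by positivity)
    exact this
  refine ⟨Real.sqrt (∫ ξ, b ξ), fun T hT v hv => Real.le_sqrt_of_sq_le ?_⟩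
  rw [SignalL2.norm_sq_eq_integral]
  refine integral_mono_ae (SignalL2.integrable_norm_sq v) hbi ?_
  filter_upwards [hv, norm_fourier_windowedSinusoid_le ω hT] with ξ h1 h2
  rw [h1]
  by_cases hmem : δ ≤ |ω - 2 * Real.pi * ξ|
  · rw [indicator_of_mem (show ξ ∈ {ξ : ℝ | δ ≤ |ω - 2 * Real.pi * ξ|} from hmem)]
    have hs : 0 < |ω - 2 * Real.pi * ξ| := hδ.trans_le hmem
    have h3 := h2 (sub_ne_zero.1 (abs_pos.1 hs))
    have h4 : δ ^ 2 ≤ (ω - 2 * Real.pi * ξ) ^ 2 := by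
      rw [← sq_abs (ω - _)]
      gcongr
    have h5 : 0 < (ω - 2 * Real.pi * ξ) ^ 2 := lt_of_lt_of_le (by positivity) h4
    calc _ ≤ (2 / |ω - 2 * Real.pi * ξ|) ^ 2 := by gcongr
      _ = 4 / (ω - 2 * Real.pi * ξ) ^ 2 := by rw [div_pow, sq_abs]; norm_num
      _ ≤ b ξ := by
        rw [hb]
        simp only
        rw [← div_eq_mul_inv, div_le_div_iff₀ h5 (by positivity)]
        have : 1 ≤ 1 / δ ^ 2 * (ω - 2 * Real.pi * ξ) ^ 2 := by
          rw [one_div, inv_mul_eq_div, le_div_iff₀ (by positivity)]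
          linarith
        nlinarith
  · rw [indicator_of_notMem (show ξ ∉ {ξ : ℝ | δ ≤ |ω - 2 * Real.pi * ξ|} from hmem)]
    rw [norm_zero, zero_pow two_ne_zero]
    simp only [hb]
    positivity

/-- The windowed sinusoid of unit norm. -/
noncomputable def unitSinusoid (ω T : ℝ) : SignalL2 :=
  (((Real.sqrt (2 * T))⁻¹ : ℝ) : ℂ) • windowedSinusoid ω T

theorem tendsto_inv_sqrt_window :
    Tendsto (fun T : ℝ => (Real.sqrt (2 * T))⁻¹) atTop (𝓝 0) :=
  (Real.tendsto_sqrt_atTop.comp (tendsto_id.const_mul_atTop two_pos)).inv_tendsto_atTop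

theorem norm_unitSinusoid (ω : ℝ) {T : ℝ} (hT : 0 < T) : ‖unitSinusoid ω T‖ = 1 := by
  rw [unitSinusoid, norm_smul, Complex.norm_real, Real.norm_of_nonneg (by positivity),
    ← norm_sq_windowedSinusoid ω hT.le, Real.sqrt_sq (norm_nonneg _)]
  refine inv_mul_cancel₀ fun h => ?_
  have := norm_sq_windowedSinusoid ω hT.le
  rw [h] at this
  linarith

theorem tendsto_inner_unitSinusoid (ω ω' : ℝ) :
    Tendsto (fun T => inner ℂ (unitSinusoid ω T) (unitSinusoid ω' T)) atTop
      (𝓝 (if ω = ω' then 1 else 0)) := by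
  split_ifs with h
  · subst h
    refine tendsto_const_nhds.congr' ?_
    filter_upwards [eventually_gt_atTop 0] with T hT
    rw [inner_self_eq_norm_sq_to_K, norm_unitSinusoid ω hT]
    simp
  · have hne : ω' - ω ≠ 0 := sub_ne_zero.2 (Ne.symm h)
    refine squeeze_zero_norm' (a := fun T : ℝ =>
      (Real.sqrt (2 * T))⁻¹ * ((Real.sqrt (2 * T))⁻¹ * (2 / |ω' - ω|))) ?_ ?_
    · filter_upwards [eventually_ge_atTop 0] with T hT
      simp only [unitSinusoid, inner_smul_left, inner_smul_right, norm_mul, Complex.conj_ofReal,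
        Complex.norm_real, Real.norm_of_nonneg (inv_nonneg.2 (Real.sqrt_nonneg _)),
        inner_windowedSinusoid]
      gcongr
      exact norm_integral_exp_window_le hne hT
    · simpa using tendsto_inv_sqrt_window.mul (tendsto_inv_sqrt_window.mul_const (2 / |ω' - ω|))

/-! ### Sinusoids are asymptotic eigenvectors -/

/-- The defect of a windowed sinusoid from being an eigenvector. The part of the spectrum near `ω`
contributes little since the symbol `c` is continuous, the part away from `ω` has bounded energy. It
is estimated by the operator norm, so that no bound on the symbol is needed. -/
theorem exists_norm_multiplier_windowedSinusoid_le {g : SignalL2 →ₗ[ℂ] SignalL2} {c : ℝ → ℂ}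
    (hc : Continuous c)
    (hm : ∀ u : SignalL2, ((𝓕 (g u) : SignalL2) : ℝ → ℂ) =ᵐ[volume]
      fun ξ => c (2 * Real.pi * ξ) * ((𝓕 u : SignalL2) : ℝ → ℂ) ξ) (ω : ℝ) {ε : ℝ} (hε : 0 < ε) :
    ∃ B : ℝ, ∀ T : ℝ, 0 ≤ T → ‖g (windowedSinusoid ω T) - c ω • windowedSinusoid ω T‖ ≤
      ε * ‖windowedSinusoid ω T‖ + B := by
  obtain ⟨C, hC0, hC⟩ : ∃ C : ℝ, 0 ≤ C ∧ ∀ u, ‖g u‖ ≤ C * ‖u‖ :=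
    ⟨_, norm_nonneg _, (⟨g, continuous_of_multiplier hm⟩ : SignalL2 →L[ℂ] SignalL2).le_opNorm⟩
  obtain ⟨δ, hδ, hδc⟩ := Metric.continuousAt_iff.1 (hc.continuousAt (x := ω)) ε hε
  obtain ⟨M, hM⟩ := exists_bound_fourier_windowedSinusoid ω hδ
  refine ⟨(C + ‖c ω‖) * M, fun T hT => ?_⟩
  set W := windowedSinusoid ω T with hW
  set F : Set ℝ := {ξ : ℝ | δ ≤ |ω - 2 * Real.pi * ξ|} with hF
  have hFm : MeasurableSet F := by
    refine measurableSet_le measurable_const ?_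
    fun_prop
  have hv := (Lp.memLp (𝓕 W : SignalL2)).indicator hFm
  -- Split the windowed sinusoid into `u`, with spectrum away from `ω`, and `W - u`, with spectrum
  -- near `ω`.
  set v : SignalL2 := hv.toLp _
  set u : SignalL2 := 𝓕⁻ v
  have hu : (𝓕 u : SignalL2) = v := (Lp.fourierTransformₗᵢ ℝ ℂ).apply_symm_apply v
  have hfar : ‖g u - c ω • u‖ ≤ (C + ‖c ω‖) * M := by
    have hun : ‖u‖ ≤ M := by
      rw [← Lp.norm_fourier_eq u, hu]
      exact hM T hT v hv.coeFn_toLp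
    calc ‖g u - c ω • u‖ ≤ C * ‖u‖ + ‖c ω‖ * ‖u‖ :=
          (norm_sub_le _ _).trans (add_le_add (hC u) (norm_smul_le _ _))
      _ = (C + ‖c ω‖) * ‖u‖ := by ring
      _ ≤ _ := by gcongr
  have hnear : ‖g (W - u) - c ω • (W - u)‖ ≤ ε * ‖W‖ := by
    have hsplit : ∀ x : SignalL2, (𝓕 (g x - c ω • x) : SignalL2) = 𝓕 (g x) - c ω • 𝓕 x :=
      fun x => by
        change Lp.fourierTransformₗᵢ ℝ ℂ _ = _
        rw [map_sub, map_smul]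
        rfl
    have hsub : (𝓕 (W - u) : SignalL2) = 𝓕 W - v := by
      rw [← hu]
      exact map_sub (Lp.fourierTransformₗᵢ ℝ ℂ) W u
    rw [← Lp.norm_fourier_eq (g (W - u) - _), ← Lp.norm_fourier_eq W, hsplit]
    refine Lp.norm_le_mul_norm_of_ae_le_mul ?_
    filter_upwards [Lp.coeFn_sub (𝓕 (g (W - u)) : SignalL2) (c ω • 𝓕 (W - u)),
      Lp.coeFn_smul (c ω) (𝓕 (W - u) : SignalL2), hm (W - u), Lp.coeFn_sub (𝓕 W : SignalL2) v,
      hv.coeFn_toLp] with ξ h1 h2 h3 h4 h5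
    rw [h1, Pi.sub_apply, h2, Pi.smul_apply, h3, smul_eq_mul, ← sub_mul, hsub, h4, Pi.sub_apply,
      h5, norm_mul]
    by_cases hmem : ξ ∈ F
    · rw [indicator_of_mem hmem, sub_self, norm_zero, mul_zero]
      positivity
    · rw [indicator_of_notMem hmem, sub_zero]
      gcongr
      rw [← dist_eq_norm]
      refine (hδc ?_).le
      rw [dist_comm, Real.dist_eq]
      exact not_le.1 hmem
  calc ‖g W - c ω • W‖ = ‖(g (W - u) - c ω • (W - u)) + (g u - c ω • u)‖ := by
        congr 1
        rw [map_sub, smul_sub]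
        abel
    _ ≤ _ := (norm_add_le _ _).trans (add_le_add hnear hfar)

theorem tendsto_multiplier_unitSinusoid {g : SignalL2 →ₗ[ℂ] SignalL2} {c : ℝ → ℂ}
    (hc : Continuous c)
    (hm : ∀ u : SignalL2, ((𝓕 (g u) : SignalL2) : ℝ → ℂ) =ᵐ[volume]
      fun ξ => c (2 * Real.pi * ξ) * ((𝓕 u : SignalL2) : ℝ → ℂ) ξ) (ω : ℝ) :
    Tendsto (fun T => g (unitSinusoid ω T) - c ω • unitSinusoid ω T) atTop (𝓝 0) := by
  rw [Metric.tendsto_nhds]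
  intro ε hε
  obtain ⟨B, hB⟩ := exists_norm_multiplier_windowedSinusoid_le hc hm ω (half_pos hε)
  have hlim : Tendsto (fun T : ℝ => (Real.sqrt (2 * T))⁻¹ * B) atTop (𝓝 0) := by
    simpa using tendsto_inv_sqrt_window.mul_const B
  filter_upwards [eventually_gt_atTop 0, hlim.eventually_lt_const (half_pos hε)] with T hT hTB
  have hnn : 0 ≤ (Real.sqrt (2 * T))⁻¹ := inv_nonneg.2 (Real.sqrt_nonneg _)
  have hone := norm_unitSinusoid ω hT
  rw [unitSinusoid, norm_smul, Complex.norm_real, Real.norm_of_nonneg hnn] at hone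
  rw [dist_zero_right, unitSinusoid, map_smul, smul_comm (c ω), ← smul_sub, norm_smul,
    Complex.norm_real, Real.norm_of_nonneg hnn]
  calc _ ≤ (Real.sqrt (2 * T))⁻¹ * (ε / 2 * ‖windowedSinusoid ω T‖ + B) := by
        gcongr
        exact hB T hT.le
    _ = ε / 2 * ((Real.sqrt (2 * T))⁻¹ * ‖windowedSinusoid ω T‖) +
        (Real.sqrt (2 * T))⁻¹ * B := by ring
    _ < ε := by rw [hone]; linarith

/-! ### The scaled relative graph of a convolution operator -/

section Main

variable {g : SignalL2 →ₗ[ℂ] SignalL2} {c : ℝ → ℂ}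

theorem truncatedInput_sub (s₁ s₂ : (ℝ →₀ ℂ) × SignalL2) (T : ℝ) :
    truncatedInput s₁ T - truncatedInput s₂ T = truncatedInput (s₁ - s₂) T := by
  classical
  rw [truncatedInput_eq s₁ T (S := s₁.1.support ∪ s₂.1.support) Finset.subset_union_left,
    truncatedInput_eq s₂ T (S := s₁.1.support ∪ s₂.1.support) Finset.subset_union_right,
    truncatedInput_eq (s₁ - s₂) T (S := s₁.1.support ∪ s₂.1.support) Finsupp.support_sub]
  simp only [Prod.fst_sub, Prod.snd_sub, Finsupp.sub_apply, sub_smul, Finset.sum_sub_distrib]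
  abel

theorem srgPoint_map_eq (g : SignalL2 →ₗ[ℂ] SignalL2) (u₁ u₂ : SignalL2) :
    srgPoint g u₁ u₂ = kleinInv (srgCoord (u₁ - u₂) (g (u₁ - u₂))) := by
  rw [srgPoint_eq_kleinInv, map_sub]

/-- For a linear operator a pair of inputs matters through its difference only. If the difference
has a sinusoidal part `∑ a ω e^{jωt}`, then its square-integrable part is asymptotically
negligible, and the points converge to the mean of `(Re c ω, |c ω|²)` with weights `|a ω|²`. -/
theorem tendsto_truncatedInput (hc : Continuous c)
    (hm : ∀ u : SignalL2, ((𝓕 (g u) : SignalL2) : ℝ → ℂ) =ᵐ[volume]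
      fun ξ => c (2 * Real.pi * ξ) * ((𝓕 u : SignalL2) : ℝ → ℂ) ξ)
    {s : (ℝ →₀ ℂ) × SignalL2} (hs : s.1 ≠ 0) :
    0 < ∑ ω ∈ s.1.support, ‖s.1 ω‖ ^ 2 ∧
    (∀ᶠ T in atTop, truncatedInput s T ≠ 0) ∧
    Tendsto (fun T => srgCoord (truncatedInput s T) (g (truncatedInput s T))) atTop
      (𝓝 (∑ ω ∈ s.1.support, (‖s.1 ω‖ ^ 2 / ∑ ω ∈ s.1.support, ‖s.1 ω‖ ^ 2) •
        kleinMap (c ω))) := by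
  have hpos : 0 < ∑ ω ∈ s.1.support, ‖s.1 ω‖ ^ 2 :=
    Finset.sum_pos (fun ω hω => pow_pos (norm_pos_iff.2 (Finsupp.mem_support_iff.1 hω)) 2)
      (Finsupp.support_nonempty_iff.2 hs)
  refine ⟨hpos, ?_⟩
  have hn : Tendsto (fun T : ℝ => (((Real.sqrt (2 * T))⁻¹ : ℝ) : ℂ)) atTop (𝓝 0) := by
    rw [← Complex.ofReal_zero]
    exact (Complex.continuous_ofReal.tendsto _).comp tendsto_inv_sqrt_window
  have hr : ∀ v : SignalL2,
      Tendsto (fun T : ℝ => (((Real.sqrt (2 * T))⁻¹ : ℝ) : ℂ) • v) atTop (𝓝 0) := fun v => by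
    simpa using hn.smul_const v
  obtain ⟨h1, h2⟩ := tendsto_srgCoord_of_asymptotically_orthonormal (l := atTop) s.1.support s.1 c
    (fun ω => (eventually_gt_atTop 0).mono fun T hT => (norm_unitSinusoid ω hT).le)
    tendsto_inner_unitSinusoid (tendsto_multiplier_unitSinusoid hc hm) (hr s.2) (hr (g s.2))
    hpos.ne'
  have hx : ∀ T, ∑ ω ∈ s.1.support, s.1 ω • unitSinusoid ω T +
      (((Real.sqrt (2 * T))⁻¹ : ℝ) : ℂ) • s.2 =
      (((Real.sqrt (2 * T))⁻¹ : ℝ) : ℂ) • truncatedInput s T := fun T => by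
    rw [truncatedInput_eq s T subset_rfl, smul_add, Finset.smul_sum]
    simp only [unitSinusoid, smul_comm (s.1 _)]
  have hy : ∀ T, ∑ ω ∈ s.1.support, s.1 ω • g (unitSinusoid ω T) +
      (((Real.sqrt (2 * T))⁻¹ : ℝ) : ℂ) • g s.2 =
      (((Real.sqrt (2 * T))⁻¹ : ℝ) : ℂ) • g (truncatedInput s T) := fun T => by
    rw [← map_smul g _ (truncatedInput s T), ← hx, map_add, map_sum]
    simp only [map_smul]
  simp only [hx, hy] at h1 h2
  constructor
  · filter_upwards [h1.eventually_ne hpos.ne'] with T hT h0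
    simp [h0] at hT
  · refine h2.congr' ?_
    filter_upwards [eventually_gt_atTop 0] with T hT
    exact srgCoord_smul (by positivity) _ _

/-- The scaled relative graph with sinusoidal inputs is the preimage of the convex hull of the
curve `(Re c, |c|²)`, and it lies in the closure of the scaled relative graph. -/
theorem srgWithSinusoids_eq (hc : Continuous c)
    (hm : ∀ u : SignalL2, ((𝓕 (g u) : SignalL2) : ℝ → ℂ) =ᵐ[volume]
      fun ξ => c (2 * Real.pi * ξ) * ((𝓕 u : SignalL2) : ℝ → ℂ) ξ) :
    srgWithSinusoids g =
      {z | z ∈ closedUpperHalfPlane ∧ kleinMap z ∈ convexHull ℝ (kleinMap '' range c)} ∧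
    srg g ⊆ srgWithSinusoids g ∧ srgWithSinusoids g ⊆ closure (srg g) := by
  have hrange : range (fun ξ => c (2 * Real.pi * ξ)) ⊆ range c :=
    range_subset_iff.2 fun ξ => mem_range_self _
  have hL2 : ∀ {x : SignalL2}, x ≠ 0 → srgCoord x (g x) ∈ convexHull ℝ (kleinMap '' range c) :=
    fun hx => convexHull_mono (image_mono hrange) (srgCoord_mem_convexHull hm hx)
  have hinv : ∀ q ∈ convexHull ℝ (kleinMap '' range c), kleinMap (kleinInv q) = q := fun q hq =>
    kleinMap_kleinInv (convexHull_min (by rintro _ ⟨z, _, rfl⟩; exact kleinMap_mem_epigraph z)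
      convex_epigraph_sq hq)
  have hlim : ∀ {s : (ℝ →₀ ℂ) × SignalL2}, s.1 ≠ 0 →
      Tendsto (fun T => kleinInv (srgCoord (truncatedInput s T) (g (truncatedInput s T)))) atTop
      (𝓝 (kleinInv (∑ ω ∈ s.1.support,
        (‖s.1 ω‖ ^ 2 / ∑ ω ∈ s.1.support, ‖s.1 ω‖ ^ 2) • kleinMap (c ω)))) := fun hs =>
    (continuous_kleinInv.tendsto _).comp (tendsto_truncatedInput hc hm hs).2.2
  have hpt : ∀ s₁ s₂ : (ℝ →₀ ℂ) × SignalL2, ∀ T,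
      srgPoint g (truncatedInput s₁ T) (truncatedInput s₂ T) =
      kleinInv (srgCoord (truncatedInput (s₁ - s₂) T) (g (truncatedInput (s₁ - s₂) T))) :=
    fun s₁ s₂ T => by rw [srgPoint_map_eq, truncatedInput_sub]
  have hzero : ∀ (v : SignalL2) (T : ℝ), truncatedInput (0, v) T = v := fun v T => by
    rw [truncatedInput_eq _ T subset_rfl]
    simp
  refine ⟨Subset.antisymm ?_ ?_, ?_, ?_⟩
  · rintro z ⟨s₁, s₂, hne, hz⟩
    simp only [hpt] at hz
    obtain ⟨q, hq, rfl⟩ : ∃ q ∈ convexHull ℝ (kleinMap '' range c), z = kleinInv q := by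
      -- Without a sinusoidal part the points do not depend on the window.
      by_cases hs : (s₁ - s₂).1 = 0
      · have hv : (s₁ - s₂).2 ≠ 0 := fun h => hne (sub_eq_zero.1 (Prod.ext hs h))
        obtain ⟨v, hv'⟩ : ∃ v, s₁ - s₂ = (0, v) := ⟨_, Prod.ext hs rfl⟩
        rw [hv'] at hz hv
        simp only [hzero] at hz
        exact ⟨_, hL2 hv, tendsto_nhds_unique hz tendsto_const_nhds⟩
      · refine ⟨_, ?_, tendsto_nhds_unique hz (hlim hs)⟩
        have hpos := (tendsto_truncatedInput hc hm hs).1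
        refine (convex_convexHull ℝ _).sum_mem (fun ω _ => by positivity) ?_ fun ω _ =>
          subset_convexHull ℝ _ (mem_image_of_mem _ (mem_range_self ω))
        rw [← Finset.sum_div, div_self hpos.ne']
    exact ⟨kleinInv_mem q, (hinv q hq).symm ▸ hq⟩
  · rintro z ⟨hz, hzm⟩
    rw [← range_comp, convexHull_range_eq_exists_affineCombination] at hzm
    obtain ⟨t, w, hw0, hw1, hwz⟩ := hzm
    rw [affineCombination_eq_centerMass hw1, Finset.centerMass_eq_of_sum_1 _ _ hw1] at hwz
    -- The amplitudes are the square roots of the weights.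
    set a : ℝ →₀ ℂ := Finsupp.indicator t fun ω _ => (Real.sqrt (w ω) : ℂ) with ha
    have hat : a.support ⊆ t := Finsupp.support_indicator_subset _ _
    have hval : ∀ ω ∈ t, ‖a ω‖ ^ 2 = w ω := fun ω hω => by
      rw [ha, Finsupp.indicator_of_mem hω, Complex.norm_real,
        Real.norm_of_nonneg (Real.sqrt_nonneg _), Real.sq_sqrt (hw0 ω hω)]
    have hsum : ∑ ω ∈ a.support, ‖a ω‖ ^ 2 = 1 := by
      rw [← hw1, ← Finset.sum_congr rfl hval]
      refine Finset.sum_subset hat fun ω _ hω => ?_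
      rw [Finsupp.notMem_support_iff.1 hω]
      simp
    have ha0 : a ≠ 0 := by
      rintro h
      simp [h] at hsum
    have hq : ∑ ω ∈ a.support, (‖a ω‖ ^ 2 / ∑ ω ∈ a.support, ‖a ω‖ ^ 2) • kleinMap (c ω) =
        kleinMap z := by
      rw [← hwz, hsum]
      simp only [div_one, Function.comp_apply]
      rw [← Finset.sum_congr rfl fun ω hω => congrArg (· • kleinMap (c ω)) (hval ω hω)]
      refine Finset.sum_subset hat fun ω _ hω => ?_
      rw [Finsupp.notMem_support_iff.1 hω]
      simp
    refine ⟨(a, 0), 0, fun h => ha0 (Prod.ext_iff.1 h).1, ?_⟩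
    simp only [hpt, sub_zero]
    have := hlim (s := (a, 0)) ha0
    rwa [hq, kleinInv_kleinMap hz] at this
  · rintro z ⟨u₁, u₂, hne, rfl⟩
    refine ⟨(0, u₁), (0, u₂), fun h => hne (Prod.ext_iff.1 h).2, ?_⟩
    simp only [hzero]
    exact tendsto_const_nhds
  · rintro z ⟨s₁, s₂, hne, hz⟩
    refine mem_closure_of_tendsto hz ?_
    by_cases hs : (s₁ - s₂).1 = 0
    · refine Eventually.of_forall fun T => ⟨_, _, fun h => ?_, rfl⟩
      rw [← sub_eq_zero, truncatedInput_sub] at h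
      obtain ⟨v, hv'⟩ : ∃ v, s₁ - s₂ = (0, v) := ⟨_, Prod.ext hs rfl⟩
      rw [hv', hzero] at h
      rw [h] at hv'
      exact hne (sub_eq_zero.1 hv')
    · filter_upwards [(tendsto_truncatedInput hc hm hs).2.1] with T hT
      refine ⟨_, _, fun h => hT ?_, rfl⟩
      rw [← truncatedInput_sub, h, sub_self]

/-- The general case of the theorem, and the reason why it does not need the symmetry of the
Nyquist diagram: `kleinMap` is invariant under conjugation. -/
theorem srg_assertions_of_union_conj {G : ℂ → ℂ} (hG : IsTransferFunction g G)
    (hcont : Continuous fun ω : ℝ => G (Complex.I * (ω : ℂ))) :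
    srgWithSinusoids g ∩ closedUpperHalfPlane
        = hConvexHull ((nyquist G ∪ conj '' nyquist G) ∩ closedUpperHalfPlane) ∧
      srg g ∩ closedUpperHalfPlane
        ⊆ hConvexHull ((nyquist G ∪ conj '' nyquist G) ∩ closedUpperHalfPlane) ∧
      hConvexHull ((nyquist G ∪ conj '' nyquist G) ∩ closedUpperHalfPlane)
        ⊆ closure (srg g ∩ closedUpperHalfPlane) := by
  have himage : kleinMap '' ((nyquist G ∪ conj '' nyquist G) ∩ closedUpperHalfPlane) =
      kleinMap '' nyquist G := by
    apply Subset.antisymm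
    · rintro _ ⟨z, ⟨hz | ⟨w, hw, rfl⟩, _⟩, rfl⟩
      · exact mem_image_of_mem _ hz
      · exact ⟨w, hw, (kleinMap_conj w).symm⟩
    · rintro _ ⟨z, hz, rfl⟩
      rcases le_total 0 z.im with h | h
      · exact ⟨z, ⟨Or.inl hz, h⟩, rfl⟩
      · refine ⟨conj z, ⟨Or.inr ⟨z, hz, rfl⟩, ?_⟩, kleinMap_conj z⟩
        simpa [closedUpperHalfPlane] using h
  have hsrg : srg g ∩ closedUpperHalfPlane = srg g := by
    refine inter_eq_left.2 ?_
    rintro z ⟨u₁, u₂, _, rfl⟩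
    exact srgPoint_mem_closedUpperHalfPlane _ _ _
  obtain ⟨h1, h2, h3⟩ := srgWithSinusoids_eq (g := g) hcont hG
  have hhull : hConvexHull ((nyquist G ∪ conj '' nyquist G) ∩ closedUpperHalfPlane) =
      srgWithSinusoids g := by
    rw [hConvexHull_eq inter_subset_right, himage, h1]
    rfl
  rw [hhull, hsrg]
  refine ⟨inter_eq_left.2 ?_, h2, h3⟩
  rw [h1]
  exact fun z hz => hz.1

end Main

theorem mainTheorem1 (g : SignalL2 →ₗ[ℂ] SignalL2) (hg : IsTimeInvariant g)
    (G : ℂ → ℂ) (hG : IsTransferFunction g G)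
    (hcont : Continuous fun ω : ℝ => G (Complex.I * (ω : ℂ))) :
    ((∀ z ∈ nyquist G, conj z ∈ nyquist G) →
      srgWithSinusoids g ∩ closedUpperHalfPlane
          = hConvexHull (nyquist G ∩ closedUpperHalfPlane) ∧
      srg g ∩ closedUpperHalfPlane ⊆ hConvexHull (nyquist G ∩ closedUpperHalfPlane) ∧
      hConvexHull (nyquist G ∩ closedUpperHalfPlane)
          ⊆ closure (srg g ∩ closedUpperHalfPlane)) ∧
    (srgWithSinusoids g ∩ closedUpperHalfPlane
        = hConvexHull ((nyquist G ∪ conj '' nyquist G) ∩ closedUpperHalfPlane) ∧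
      srg g ∩ closedUpperHalfPlane
        ⊆ hConvexHull ((nyquist G ∪ conj '' nyquist G) ∩ closedUpperHalfPlane) ∧
      hConvexHull ((nyquist G ∪ conj '' nyquist G) ∩ closedUpperHalfPlane)
        ⊆ closure (srg g ∩ closedUpperHalfPlane)) := by
  refine ⟨fun hsymm => ?_, srg_assertions_of_union_conj hG hcont⟩
  have h : nyquist G ∪ conj '' nyquist G = nyquist G :=
    union_eq_left.2 (by rintro _ ⟨z, hz, rfl⟩; exact hsymm z hz)
  simpa only [h] using srg_assertions_of_union_conj hG hcont
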